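/- **Setting.** Fix a countably infinite set $\mathbb{A}$ of atoms and let $\mathfrak{S}_{\mathsf f}(\mathbb{A})$ be the group of permutations of $\mathbb{A}$ moving only finitely many atoms. Let $X$ be a set with an action of $\mathfrak{S}_{\mathsf f}(\mathbb{A})$. A set $S\subseteq\mathbb{A}$ *supports* $x\in X$ if $\pi\cdot x=x$ for every $\pi\in\mathfrak{S}_{\mathsf f}(\mathbb{A})$ with $\pi(a)=a$ for all $a\in S$. A *nominal set* is such an $X$ in which every element is supported by a finite set; $\mathrm{supp}(x)$ is the least finite set supporting $x$. $\mathsf{Nom}$ is the category of nominal sets and equivariant maps. A nominal set $X$ is *strong* if $\pi\cdot x=x$ implies $\pi(a)=a$ for all $a\in\mathrm{supp}(x)$, for all $x\in X$ and $\pi\in\mathfrak{S}_{\mathsf f}(\mathbb{A})$. Let $\mathcal{S}$ be the class of strong nominal sets. For a nominal set $X$, with the element-wise action on subsets, let * $\mathcal{P}_{\mathsf{ufs}}(X)=\{Y\subseteq X\mid\bigcup_{y\in Y}\mathrm{supp}(y)\text{ is finite}\}$ (uniformly finitely supported subsets), * $\mathcal{P}_{\mathsf f}(X)=\{Y\subseteq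 X\mid Y\text{ is finite}\}$, * $\mathcal{P}_{\mathsf{fs}}(X)=\{Y\subseteq X\mid Y\text{ is supported by a finite set}\}$. Each is an endofunctor of $\mathsf{Nom}$ acting on maps by direct image. For $T$ one of these functors, order $\mathsf{Nom}(X,TY)$ by $f\sqsubseteq g$ iff $f(x)\subseteq g(x)$ for all $x\in X$; this is a partial order with $Th\cdot f\cdot k\sqsubseteq Th\cdot g\cdot k$ whenever $f\sqsubseteq g$. Let $\eta\colon\mathrm{Id}\to T$ and $\bot\colon 1\to T$ be the natural transformations $\eta_X(x)=\{x\}$ and $\bot_X(*)=\emptyset$, and let $[\eta,\bot]_Y\colon Y+1\to TY$ be their copairing. **Proposition.** The class $\mathcal{S}$ is closed under isomorphism. For $T=\mathcal{P}_{\mathsf{ufs}}$, and likewise for $T=\mathcal{P}_{\mathsf f}$, the following axioms hold. * (Ax2) If a family $(e_i\colon X_i\to Y)_{i\in I}$ in $\mathsf{Nom}$ is jointly epic (that is, $u\cdot e_i=v\cdot e_i$ for all $i$ implies $u=v$, for all $u,v\colon Y\to Z$), then for all $f,g\colon Y\to TZ$, $f\cdot e_i\sqsubseteq g\cdot e_i$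 for all $i\in I$ implies $f\sqsubseteq g$. * (Ax3) $\bot_Y\cdot{!_X}\sqsubseteq f$ for all $f\colon X\to TY$. * (Ax4) For every $f\colon X\to TY$ with $X\in\mathcal{S}$, $f=\bigsqcup\{[\eta,\bot]_Y\cdot f'\mid f'\colon X\to Y+1,\ [\eta,\bot]_Y\cdot f'\sqsubseteq f\}$, the supremum being taken in the poset $\mathsf{Nom}(X,TY)$. * (Ax5) For every $A\in\mathcal{S}$ and all $x\colon A\to TX$, $y\colon A\to Y+1$, $h\colon X\to Y$ with $[\eta,\bot]_Y\cdot y\sqsubseteq Th\cdot x$, there is $x'\colon A\to X+1$ with $[\eta,\bot]_X\cdot x'\sqsubseteq x$ and $(h+1)\cdot x'=y$. In contrast, (Ax5) fails for $T=\mathcal{P}_{\mathsf{fs}}$. -/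

import Mathlib

open CategoryTheory CategoryTheory.Limits
open scoped Pointwise

universe u v w

noncomputable section

/-! ## Nominal sets -/

/-- The group of finite permutations of the set `𝔸` of atoms: the bijections of `𝔸` that move only
finitely many atoms. -/
def FinPerm (𝔸 : Type v) : Subgroup (Equiv.Perm 𝔸) where
  carrier := {π | {a | π a ≠ a}.Finite}
  one_mem' := by simp
  mul_mem' := by
    intro π σ hπ hσ
    refine (hπ.union hσ).subset fun a ha => ?_
    by_contra h
    simp only [Set.mem_union, Set.mem_ofPred_eq, not_or, not_not] at h
    exact ha (by simp [h.1, h.2])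
  inv_mem' := by
    intro π hπ
    refine hπ.subset fun a ha h => ha ?_
    exact Equiv.Perm.inv_eq_iff_eq.2 h.symm

/-- A nominal set over the atoms `𝔸`: a set with an action of the finite permutations of `𝔸` such
that every element is supported by a finite set of atoms. Here `MulAction.Supports (FinPerm 𝔸) S x`
says that every `π` with `π • a = π a = a` for all `a ∈ S` satisfies `π • x = x`. -/
structure Nom (𝔸 : Type v) : Type (max (u + 1) v) where
  carrier : Type u
  [action : MulAction (FinPerm 𝔸) carrier]
  exists_support : ∀ x : carrier, ∃ S : Set 𝔸, S.Finite ∧ MulAction.Supports (FinPerm 𝔸) S x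

namespace Nom

variable {𝔸 : Type v}

instance : CoeSort (Nom.{u} 𝔸) (Type u) := ⟨Nom.carrier⟩

instance (X : Nom.{u} 𝔸) : MulAction (FinPerm 𝔸) X := X.action

/-- Equivariant maps. -/
@[ext]
structure Hom (X Y : Nom.{u} 𝔸) : Type u where
  toFun : X → Y
  map_smul : ∀ (π : FinPerm 𝔸) (x : X), toFun (π • x) = π • toFun x

/-- The category of nominal sets and equivariant maps. -/
instance : Category (Nom.{u} 𝔸) where
  Hom X Y := Hom X Y
  id X := ⟨fun x => x, fun _ _ => rfl⟩
  comp f g := ⟨fun x => g.toFun (f.toFun x), fun π x => by rw [f.map_smul, g.map_smul]⟩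

@[ext]
theorem hom_ext {X Y : Nom.{u} 𝔸} {f g : X ⟶ Y} (h : ∀ x, f.toFun x = g.toFun x) : f = g :=
  Hom.ext (funext h)

@[simp]
theorem id_toFun (X : Nom.{u} 𝔸) (x : X) : (𝟙 X : X ⟶ X).toFun x = x := rfl

@[simp]
theorem comp_toFun {X Y Z : Nom.{u} 𝔸} (f : X ⟶ Y) (g : Y ⟶ Z) (x : X) :
    (f ≫ g).toFun x = g.toFun (f.toFun x) := rfl

/-- The support of `x`: the intersection of all finite sets of atoms supporting `x`. It is the
least finite set supporting `x` if `𝔸` is infinite. -/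
def supp {X : Nom.{u} 𝔸} (x : X) : Set 𝔸 :=
  {a | ∀ S : Set 𝔸, S.Finite → MulAction.Supports (FinPerm 𝔸) S x → a ∈ S}

theorem supp_subset {X : Nom.{u} 𝔸} {x : X} {S : Set 𝔸} (hS : S.Finite)
    (h : MulAction.Supports (FinPerm 𝔸) S x) : supp x ⊆ S := fun _ ha => ha S hS h

theorem finite_supp {X : Nom.{u} 𝔸} (x : X) : (supp x).Finite := by
  obtain ⟨S, hS, h⟩ := X.exists_support x
  exact hS.subset (supp_subset hS h)

theorem supports_map {X Y : Nom.{u} 𝔸} (f : X ⟶ Y) {S : Set 𝔸} {x : X}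
    (h : MulAction.Supports (FinPerm 𝔸) S x) :
    MulAction.Supports (FinPerm 𝔸) S (f.toFun x) := fun π hπ => by
  rw [← f.map_smul, h π hπ]

theorem supp_map_subset {X Y : Nom.{u} 𝔸} (f : X ⟶ Y) (x : X) : supp (f.toFun x) ⊆ supp x :=
  fun _ ha S hS h => ha S hS (supports_map f h)

theorem supports_smul {β : Type*} [MulAction (FinPerm 𝔸) β] (π : FinPerm 𝔸) {S : Set 𝔸} {x : β}
    (h : MulAction.Supports (FinPerm 𝔸) S x) :
    MulAction.Supports (FinPerm 𝔸) (π • S) (π • x) := by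
  intro σ hσ
  have : (π⁻¹ * σ * π) • x = x := h _ fun a ha => by
    rw [mul_smul, mul_smul, hσ (Set.smul_mem_smul_set ha), inv_smul_smul]
  rw [mul_smul, mul_smul, inv_smul_eq_iff] at this
  exact this

theorem supp_smul_subset {X : Nom.{u} 𝔸} (π : FinPerm 𝔸) (x : X) :
    supp (π • x) ⊆ π • supp x := by
  intro a ha
  rw [Set.mem_smul_set_iff_inv_smul_mem]
  intro S hS h
  rw [← Set.mem_smul_set_iff_inv_smul_mem]
  exact ha _ (hS.smul_set) (supports_smul π h)

open Classical in
/-- The transposition of two atoms. -/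
def transp (a b : 𝔸) : FinPerm 𝔸 :=
  ⟨Equiv.swap a b, (Set.toFinite {a, b}).subset fun c hc => by
    by_contra h
    simp only [Set.mem_insert_iff, Set.mem_singleton_iff, not_or] at h
    exact hc (Equiv.swap_apply_of_ne_of_ne h.1 h.2)⟩

theorem transp_smul (a b c : 𝔸) [DecidableEq 𝔸] : transp a b • c = Equiv.swap a b c := by
  change @Equiv.swap 𝔸 (fun a b => Classical.propDecidable (a = b)) a b c = _
  congr!

theorem supports_of_transp {β : Type*} [MulAction (FinPerm 𝔸) β] {S : Set 𝔸} {x : β}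
    (h : ∀ a b, a ∉ S → b ∉ S → transp a b • x = x) : MulAction.Supports (FinPerm 𝔸) S x := by
  classical
  have key : ∀ (n : ℕ) (π : FinPerm 𝔸), {a : 𝔸 | π • a ≠ a}.ncard = n →
      (∀ a : 𝔸, a ∈ S → π • a = a) → π • x = x := by
    intro n
    induction n using Nat.strong_induction_on with
    | _ n ih =>
      intro π hn hπ
      by_cases h1 : ∀ a : 𝔸, π • a = a
      · have : π = 1 := Subtype.ext (Equiv.ext h1)
        rw [this, one_smul]
      · push Not at h1
        obtain ⟨a, ha⟩ := h1
        have haS : a ∉ S := fun h' => ha (hπ a h')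
        have hbS : π • a ∉ S := fun h' => ha (smul_left_cancel π (hπ _ h'))
        have hlt : {c : 𝔸 | (transp a (π • a) * π) • c ≠ c} ⊂ {c : 𝔸 | π • c ≠ c} := by
          refine ⟨fun c hc hc' => hc ?_, fun hsub => hsub ha ?_⟩
          · rw [mul_smul, hc', transp_smul]
            refine Equiv.swap_apply_of_ne_of_ne ?_ ?_
            · rintro rfl
              exact ha hc'
            · intro h'
              rw [h'] at hc'
              exact ha (smul_left_cancel π hc')
          · rw [mul_smul, transp_smul, Equiv.swap_apply_right]
        have hfix : (transp a (π • a) * π) • x = x := by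
          refine ih _ ?_ _ rfl ?_
          · rw [← hn]
            exact Set.ncard_lt_ncard hlt π.2
          · intro c hc
            rw [mul_smul, hπ c hc, transp_smul]
            refine Equiv.swap_apply_of_ne_of_ne ?_ ?_
            · rintro rfl
              exact haS hc
            · rintro rfl
              exact hbS hc
        rw [mul_smul] at hfix
        have hinv := h a (π • a) haS hbS
        exact smul_left_cancel _ (hfix.trans hinv.symm)
  exact fun π hπ => key _ π rfl hπ

theorem supports_inter [Infinite 𝔸] {β : Type*} [MulAction (FinPerm 𝔸) β] {S T : Set 𝔸} {x : β}
    (hSf : S.Finite) (hTf : T.Finite) (hS : MulAction.Supports (FinPerm 𝔸) S x)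
    (hT : MulAction.Supports (FinPerm 𝔸) T x) : MulAction.Supports (FinPerm 𝔸) (S ∩ T) x := by
  classical
  have fresh : ∀ a c, a ∉ S ∩ T → c ∉ S → c ∉ T → transp a c • x = x := by
    intro a c ha hcS hcT
    by_cases h : a ∈ S
    · refine hT _ fun d hd => ?_
      rw [transp_smul]
      refine Equiv.swap_apply_of_ne_of_ne ?_ ?_
      · rintro rfl
        exact ha ⟨h, hd⟩
      · rintro rfl
        exact hcT hd
    · refine hS _ fun d hd => ?_
      rw [transp_smul]
      refine Equiv.swap_apply_of_ne_of_ne ?_ ?_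
      · rintro rfl
        exact h hd
      · rintro rfl
        exact hcS hd
  refine supports_of_transp fun a b ha hb => ?_
  obtain ⟨c, hc⟩ := ((hSf.union hTf).union (Set.toFinite {a, b})).exists_notMem
  simp only [Set.mem_union, Set.mem_insert_iff, Set.mem_singleton_iff, not_or] at hc
  obtain ⟨⟨hcS, hcT⟩, hca, hcb⟩ := hc
  by_cases hab : a = b
  · subst hab
    have : transp a a = 1 := Subtype.ext (Equiv.ext fun d => by
      change transp a a • d = d
      rw [transp_smul]
      simp)
    rw [this, one_smul]
  have hconj : transp a b = transp a c * transp b c * transp a c := by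
    refine Subtype.ext (Equiv.ext fun d => ?_)
    change transp a b • d = (transp a c * transp b c * transp a c) • d
    simp only [mul_smul, transp_smul, Equiv.swap_apply_def]
    split_ifs <;> simp_all
  rw [hconj, mul_smul, mul_smul, fresh a c ha hcS hcT, fresh b c hb hcS hcT,
    fresh a c ha hcS hcT]

/-- The support of `x` supports `x`. -/
theorem supports_supp [Infinite 𝔸] {X : Nom.{u} 𝔸} (x : X) :
    MulAction.Supports (FinPerm 𝔸) (supp x) x := by
  classical
  refine supports_of_transp fun a b ha hb => ?_
  simp only [supp, Set.mem_ofPred_eq, not_forall] at ha hb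
  obtain ⟨S, hSf, hS, haS⟩ := ha
  obtain ⟨T, hTf, hT, hbT⟩ := hb
  refine supports_inter hSf hTf hS hT _ fun d hd => ?_
  rw [transp_smul]
  refine Equiv.swap_apply_of_ne_of_ne ?_ ?_
  · rintro rfl
    exact haS hd.1
  · rintro rfl
    exact hbT hd.2

/-- A nominal set is strong if the permutations fixing an element fix all atoms in its support. -/
def strong (𝔸 : Type v) : ObjectProperty (Nom.{u} 𝔸) :=
  fun X => ∀ (x : X) (π : FinPerm 𝔸), π • x = x → ∀ a ∈ supp x, π • a = a

/-! ### Terminal object and binary coproducts -/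

/-- The one-element nominal set. -/
def one (𝔸 : Type v) : Nom.{u} 𝔸 :=
  letI : MulAction (FinPerm 𝔸) PUnit.{u + 1} :=
    { smul := fun _ x => x, one_smul := fun _ => rfl, mul_smul := fun _ _ _ => rfl }
  { carrier := PUnit.{u + 1}
    exists_support := fun _ => ⟨∅, Set.finite_empty, fun _ _ => rfl⟩ }

instance : HasTerminal (Nom.{u} 𝔸) :=
  IsTerminal.hasTerminal (X := one 𝔸) <| IsTerminal.ofUniqueHom
    (fun _ => ⟨fun _ => PUnit.unit, fun _ _ => rfl⟩) (fun _ _ => rfl)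

/-- The disjoint union of two nominal sets. -/
def sum (X Y : Nom.{u} 𝔸) : Nom.{u} 𝔸 :=
  letI : MulAction (FinPerm 𝔸) (X ⊕ Y) :=
    { smul := fun π => Sum.map (π • ·) (π • ·)
      one_smul := by
        rintro (x | x)
        · exact congrArg Sum.inl (one_smul _ x)
        · exact congrArg Sum.inr (one_smul _ x)
      mul_smul := by
        rintro π σ (x | x)
        · exact congrArg Sum.inl (mul_smul π σ x)
        · exact congrArg Sum.inr (mul_smul π σ x) }
  { carrier := X ⊕ Y
    exists_support := by
      rintro (x | x)
      · obtain ⟨S, hS, h⟩ := X.exists_support x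
        exact ⟨S, hS, fun π hπ => congrArg Sum.inl (h π hπ)⟩
      · obtain ⟨S, hS, h⟩ := Y.exists_support x
        exact ⟨S, hS, fun π hπ => congrArg Sum.inr (h π hπ)⟩ }

/-- The left injection into the disjoint union. -/
def inl (X Y : Nom.{u} 𝔸) : X ⟶ sum X Y := ⟨Sum.inl, fun _ _ => rfl⟩

/-- The right injection into the disjoint union. -/
def inr (X Y : Nom.{u} 𝔸) : Y ⟶ sum X Y := ⟨Sum.inr, fun _ _ => rfl⟩

/-- The disjoint union as a cofan. -/
def sumCofan (X Y : Nom.{u} 𝔸) : BinaryCofan X Y := BinaryCofan.mk (inl X Y) (inr X Y)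

/-- The disjoint union is a coproduct in the category of nominal sets. -/
def sumCofanIsColimit (X Y : Nom.{u} 𝔸) : IsColimit (sumCofan X Y) :=
  BinaryCofan.isColimitMk
    (fun s => ⟨Sum.elim s.inl.toFun s.inr.toFun, by
      rintro π (x | x)
      · exact s.inl.map_smul π x
      · exact s.inr.map_smul π x⟩)
    (fun _ => rfl) (fun _ => rfl)
    (fun s m h₁ h₂ => by
      refine hom_ext ?_
      rintro (x | x)
      · exact congrFun (congrArg Hom.toFun h₁) x
      · exact congrFun (congrArg Hom.toFun h₂) x)

instance : HasBinaryCoproducts (Nom.{u} 𝔸) :=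
  have : ∀ {X Y : Nom.{u} 𝔸}, HasColimit (pair X Y) := fun {X Y} =>
    ⟨⟨⟨sumCofan X Y, sumCofanIsColimit X Y⟩⟩⟩
  hasBinaryCoproducts_of_hasColimit_pair _

end Nom

/-! ## The axioms on the branching functor -/

section Axioms

variable {C : Type v} [Category.{u} C]

/-- A partial order on `T`-homsets: a partial order on each homset `X ⟶ T.obj Y`, functorial in
`X` and `Y`, that is, a lifting of the functor `(X, Y) ↦ (X ⟶ T.obj Y)` along the forgetful functor
from posets to sets. -/
structure HomsetOrder (T : C ⥤ C) where
  le : ∀ {X Y : C}, (X ⟶ T.obj Y) → (X ⟶ T.obj Y) → Prop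
  refl : ∀ {X Y : C} (f : X ⟶ T.obj Y), le f f
  trans : ∀ {X Y : C} (f g k : X ⟶ T.obj Y), le f g → le g k → le f k
  antisymm : ∀ {X Y : C} (f g : X ⟶ T.obj Y), le f g → le g f → f = g
  functorial : ∀ {X X' Y Y' : C} (f₁ f₂ : X ⟶ T.obj Y) (g : X' ⟶ X) (h : Y ⟶ Y'),
    le f₁ f₂ → le (g ≫ f₁ ≫ T.map h) (g ≫ f₂ ≫ T.map h)

/-- The partial order on a single homset. -/
abbrev HomsetOrder.partialOrder {T : C ⥤ C} (O : HomsetOrder T) (X Y : C) :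
    PartialOrder (X ⟶ T.obj Y) where
  le := O.le
  le_refl := O.refl
  le_trans := O.trans
  le_antisymm := O.antisymm

/-- A family of morphisms with common codomain is jointly epic if any two morphisms that agree
after precomposition with every member of the family are equal. -/
def JointlyEpic {ι : Type w} {X : ι → C} {Y : C} (e : ∀ i, X i ⟶ Y) : Prop :=
  ∀ ⦃Z : C⦄ (f g : Y ⟶ Z), (∀ i, e i ≫ f = e i ≫ g) → f = g

/-- Order-reflection along jointly epic families: if `f · eᵢ ⊑ g · eᵢ` for all `i`, then
`f ⊑ g`. -/
def AxJointlyEpic {T : C ⥤ C} (O : HomsetOrder T) : Prop :=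
  ∀ ⦃ι : Type w⦄ (X : ι → C) (Y Z : C) (e : ∀ i, X i ⟶ Y), JointlyEpic e →
    ∀ f g : Y ⟶ T.obj Z, (∀ i, O.le (e i ≫ f) (e i ≫ g)) → O.le f g

variable [HasTerminal C]

/-- `⊥_Y · !_X ⊑ f` for all `f : X ⟶ T Y`, where `⊥ : 1 ⟶ T` is a natural transformation. -/
def AxBot {T : C ⥤ C} (O : HomsetOrder T) (bot : (Functor.const C).obj (⊤_ C) ⟶ T) : Prop :=
  ∀ ⦃X Y : C⦄ (f : X ⟶ T.obj Y), O.le (terminal.from X ≫ bot.app Y) f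

variable [HasBinaryCoproducts C]

/-- The component `[η, ⊥]_Y : Y + 1 ⟶ T Y` of the copairing of `η : Id ⟶ T` and `⊥ : 1 ⟶ T`. -/
def unitBot {T : C ⥤ C} (η : 𝟭 C ⟶ T) (bot : (Functor.const C).obj (⊤_ C) ⟶ T) (Y : C) :
    Y ⨿ ⊤_ C ⟶ T.obj Y :=
  coprod.desc (η.app Y) (bot.app Y)

/-- For every `f : X ⟶ T Y` with `X ∈ 𝒮`, `f = ⨆ {[η, ⊥]_Y · f' ⊑ f | f' : X ⟶ Y + 1}`, the
supremum being taken in the poset `X ⟶ T Y`. -/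
def AxJoin (S : ObjectProperty C) {T : C ⥤ C} (O : HomsetOrder T) (η : 𝟭 C ⟶ T)
    (bot : (Functor.const C).obj (⊤_ C) ⟶ T) : Prop :=
  ∀ ⦃X Y : C⦄, S X → ∀ f : X ⟶ T.obj Y,
    letI := O.partialOrder X Y
    IsLUB {g | g ≤ f ∧ ∃ f' : X ⟶ Y ⨿ ⊤_ C, g = f' ≫ unitBot η bot Y} f

/-- The choice principle: for `A ∈ 𝒮`, if `[η, ⊥]_Y · y ⊑ T h · x`, then there is
`x' : A ⟶ X + 1` with `[η, ⊥]_X · x' ⊑ x` and `(h + 1) · x' = y`. -/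
def AxChoice (S : ObjectProperty C) {T : C ⥤ C} (O : HomsetOrder T) (η : 𝟭 C ⟶ T)
    (bot : (Functor.const C).obj (⊤_ C) ⟶ T) : Prop :=
  ∀ ⦃A X Y : C⦄, S A → ∀ (x : A ⟶ T.obj X) (y : A ⟶ Y ⨿ ⊤_ C) (h : X ⟶ Y),
    O.le (y ≫ unitBot η bot Y) (x ≫ T.map h) →
      ∃ x' : A ⟶ X ⨿ ⊤_ C, O.le (x' ≫ unitBot η bot X) x ∧ x' ≫ coprod.map h (𝟙 (⊤_ C)) = y

/-- The axioms on the branching functor `T` with the order `O` on `T`-homsets and the natural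
transformations `η : Id ⟶ T` and `⊥ : 1 ⟶ T`, with respect to the class `S` of objects. -/
structure BranchingAxioms (S : ObjectProperty C) {T : C ⥤ C} (O : HomsetOrder T) (η : 𝟭 C ⟶ T)
    (bot : (Functor.const C).obj (⊤_ C) ⟶ T) : Prop where
  jointlyEpic : AxJointlyEpic.{u, v, w} O
  isBot : AxBot O bot
  join : AxJoin S O η bot
  choice : AxChoice S O η bot

end Axioms

/-! ## Powerset functors on nominal sets -/

/-- A variant of the powerset on nominal sets: a choice, for every nominal set `X`, of certain
finitely supported subsets of `X` (with respect to the element-wise action on subsets), including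
`∅` and the singletons, that is closed under the action and under images along equivariant maps. -/
structure PowersetVariant (𝔸 : Type v) where
  mem : ∀ X : Nom.{u} 𝔸, Set X → Prop
  exists_support : ∀ {X : Nom.{u} 𝔸} {A : Set X}, mem X A →
    ∃ S : Set 𝔸, S.Finite ∧ MulAction.Supports (FinPerm 𝔸) S A
  smul_mem : ∀ {X : Nom.{u} 𝔸} {A : Set X} (π : FinPerm 𝔸), mem X A → mem X (π • A)
  image_mem : ∀ {X Y : Nom.{u} 𝔸} {A : Set X} (f : X ⟶ Y), mem X A → mem Y (f.toFun '' A)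
  empty_mem : ∀ X : Nom.{u} 𝔸, mem X ∅
  singleton_mem : ∀ {X : Nom.{u} 𝔸} (x : X), mem X {x}

namespace PowersetVariant

variable {𝔸 : Type v} (P : PowersetVariant.{u} 𝔸)

/-- The nominal set of the subsets of `X` belonging to `P`, with the element-wise action. -/
def obj (X : Nom.{u} 𝔸) : Nom.{u} 𝔸 :=
  letI : MulAction (FinPerm 𝔸) {A : Set X // P.mem X A} :=
    { smul := fun π A => ⟨π • A.1, P.smul_mem π A.2⟩
      one_smul := fun A => Subtype.ext (one_smul _ A.1)
      mul_smul := fun π σ A => Subtype.ext (mul_smul π σ A.1) }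
  { carrier := {A : Set X // P.mem X A}
    exists_support := fun A => by
      obtain ⟨S, hS, h⟩ := P.exists_support A.2
      exact ⟨S, hS, fun π hπ => Subtype.ext (h π hπ)⟩ }

/-- The powerset functor, mapping `f` to the direct image map `A ↦ f[A]`. -/
def functor : Nom.{u} 𝔸 ⥤ Nom.{u} 𝔸 where
  obj X := P.obj X
  map {X Y} f := ⟨fun A => ⟨f.toFun '' A.1, P.image_mem f A.2⟩, fun π A => Subtype.ext (by
    change f.toFun '' (π • A.1) = π • (f.toFun '' A.1)
    ext y
    simp only [Set.mem_image, Set.mem_smul_set]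
    constructor
    · rintro ⟨_, ⟨x, hx, rfl⟩, rfl⟩
      exact ⟨_, ⟨x, hx, rfl⟩, (f.map_smul π x).symm⟩
    · rintro ⟨_, ⟨x, hx, rfl⟩, rfl⟩
      exact ⟨_, ⟨x, hx, rfl⟩, f.map_smul π x⟩)⟩
  map_id X := Nom.hom_ext fun A => Subtype.ext (Set.image_id A.1)
  map_comp f g := Nom.hom_ext fun A => Subtype.ext (Set.image_comp g.toFun f.toFun A.1)

/-- The point-wise inclusion order on homsets into powersets. -/
def pointwise : HomsetOrder P.functor where
  le {X Y} f g := ∀ x : X, (f.toFun x).1 ⊆ (g.toFun x).1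
  refl _ _ := subset_rfl
  trans _ _ _ hfg hgk x := (hfg x).trans (hgk x)
  antisymm _ _ hfg hgf := Nom.hom_ext fun x => Subtype.ext ((hfg x).antisymm (hgf x))
  functorial _ _ g h hf x := Set.image_mono (f := h.toFun) (hf (g.toFun x))

/-- The natural transformation `x ↦ {x}`. -/
def singleton : 𝟭 (Nom.{u} 𝔸) ⟶ P.functor where
  app X := ⟨fun x => ⟨{x}, P.singleton_mem x⟩, fun π x => Subtype.ext (by
    change ({π • x} : Set X) = π • {x}
    rw [Set.smul_set_singleton])⟩
  naturality _ _ f := Nom.hom_ext fun x => Subtype.ext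
    (Set.image_singleton (f := f.toFun) (a := x)).symm

/-- The natural transformation `* ↦ ∅`. -/
def empty : (Functor.const (Nom.{u} 𝔸)).obj (⊤_ (Nom.{u} 𝔸)) ⟶ P.functor where
  app X := ⟨fun _ => ⟨∅, P.empty_mem X⟩, fun π _ => Subtype.ext (by
    change (∅ : Set X) = π • ∅
    rw [Set.smul_set_empty])⟩
  naturality _ _ f := Nom.hom_ext fun _ => Subtype.ext (Set.image_empty f.toFun).symm

/-- A set of elements with a common supporting set of atoms is supported by that set. -/
theorem supports_of_forall {X : Nom.{u} 𝔸} {A : Set X} {S : Set 𝔸}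
    (h : ∀ x ∈ A, MulAction.Supports (FinPerm 𝔸) S x) : MulAction.Supports (FinPerm 𝔸) S A := by
  intro π hπ
  have : ∀ x ∈ A, π • x = x := fun x hx => h x hx π hπ
  change (π • ·) '' A = A
  rw [Set.image_congr this, Set.image_id']

/-- The uniformly finitely supported subsets: those `A ⊆ X` for which the union of the supports of
the elements of `A` is finite. -/
def ufs (𝔸 : Type v) [Infinite 𝔸] : PowersetVariant.{u} 𝔸 where
  mem X A := (⋃ x ∈ A, Nom.supp x).Finite
  exists_support {X A} hA := ⟨_, hA, supports_of_forall fun x hx =>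
    (Nom.supports_supp x).mono (Set.subset_biUnion_of_mem hx)⟩
  smul_mem {X A} π hA := by
    refine (hA.smul_set (a := π)).subset (Set.iUnion₂_subset ?_)
    rintro _ ⟨x, hx, rfl⟩
    exact (Nom.supp_smul_subset π x).trans
      (Set.smul_set_mono (Set.subset_biUnion_of_mem (u := fun x => Nom.supp x) hx))
  image_mem {_ _ A} f hA := by
    refine hA.subset (Set.iUnion₂_subset ?_)
    rintro _ ⟨x, hx, rfl⟩
    exact (Nom.supp_map_subset f x).trans
      (Set.subset_biUnion_of_mem (u := fun x => Nom.supp x) hx)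
  empty_mem X := by simp
  singleton_mem x := by simpa using Nom.finite_supp x

/-- The finite subsets. -/
def finite (𝔸 : Type v) : PowersetVariant.{u} 𝔸 where
  mem X A := A.Finite
  exists_support {X A} hA := by
    choose S hS h using X.exists_support
    exact ⟨⋃ x ∈ A, S x, hA.biUnion fun x _ => hS x, supports_of_forall fun x hx =>
      (h x).mono (Set.subset_biUnion_of_mem hx)⟩
  smul_mem π hA := hA.smul_set
  image_mem f hA := hA.image _
  empty_mem X := Set.finite_empty
  singleton_mem x := Set.finite_singleton x

/-- The finitely supported subsets. -/
def fs (𝔸 : Type v) : PowersetVariant.{u} 𝔸 where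
  mem X A := ∃ S : Set 𝔸, S.Finite ∧ MulAction.Supports (FinPerm 𝔸) S A
  exists_support h := h
  smul_mem := by
    rintro X A π ⟨S, hS, h⟩
    exact ⟨π • S, hS.smul_set, Nom.supports_smul π h⟩
  image_mem := by
    rintro X Y A f ⟨S, hS, h⟩
    refine ⟨S, hS, fun π hπ => ?_⟩
    have key : π • (f.toFun '' A) = f.toFun '' (π • A) := by
      change (π • ·) '' (f.toFun '' A) = f.toFun '' ((π • ·) '' A)
      rw [Set.image_image, Set.image_image]
      exact Set.image_congr fun x _ => (f.map_smul π x).symm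
    rw [key, h π hπ]
  empty_mem X := ⟨∅, Set.finite_empty, fun π _ => Set.smul_set_empty⟩
  singleton_mem {X} x := by
    obtain ⟨S, hS, h⟩ := X.exists_support x
    exact ⟨S, hS, fun π hπ => by rw [Set.smul_set_singleton, h π hπ]⟩

end PowersetVariant

end

/-!
The whole proposition rests on two facts about an infinite set of atoms.

* `supports_of_mem_ufs`: a finite set of atoms that supports a uniformly finitely supported set `A`
  supports every element of `A`. Otherwise some `x ∈ A` has an atom `a` in its support outside the
  supporting set; swapping `a` with a completely fresh atom `b` fixes `A`, so `A` contains an element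
  with `b` in its support, although `b` is fresh for all elements of `A`.
* `exists_hom_of_rel`: if `A` is strong, an equivariant relation from `A` to `B` that relates each
  `a` to some `b` supported by `supp a` contains the graph of an equivariant map `A ⟶ B`. The map is
  chosen freely on one representative `r` of each orbit and extended by `π • r ↦ π • b`. This is well
  defined because permutations that agree on `r` agree on `supp r`, by strength, and hence on `b`.

For an equivariant `f : A ⟶ T X` into a powerset functor with uniformly finitely supported values,
the elements of `f a` are supported by `supp a`. So both the join and the choice axiom become
instances of the choice of an equivariant map into `X + 1`. The axiom on jointly epic families only
uses that such families are jointly surjective. For finitely supported subsets the choice axiom fails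
because the set of all atoms is an element of the powerset with empty support, whereas no atom is
fixed by all permutations.
-/

noncomputable section

namespace Nom

variable {𝔸 : Type v}

/-! ### Supports and strong nominal sets -/

theorem supp_smul {X : Nom.{u} 𝔸} (π : FinPerm 𝔸) (x : X) : supp (π • x) = π • supp x := by
  refine (supp_smul_subset π x).antisymm ?_
  have h := supp_smul_subset π⁻¹ (π • x)
  rwa [inv_smul_smul, Set.subset_smul_set_iff, inv_inv] at h

theorem strong_isClosedUnderIsomorphisms (𝔸 : Type v) :
    (strong.{u} 𝔸).IsClosedUnderIsomorphisms where
  of_iso {X Y} e hX y π hπ a ha := by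
    have hy : e.hom.toFun (e.inv.toFun y) = y := congrArg (fun k => Hom.toFun k y) e.inv_hom_id
    refine hX (e.inv.toFun y) π (by rw [← e.inv.map_smul, hπ]) a ?_
    rw [← hy] at ha
    exact supp_map_subset e.hom _ ha

/-- Equivariant choice: a strong nominal set is projective with respect to equivariant relations
whose witnesses introduce no new atoms. -/
theorem exists_hom_of_rel {A B : Nom.{u} 𝔸} (hA : strong 𝔸 A) (R : A → B → Prop)
    (hR : ∀ (π : FinPerm 𝔸) a b, R a b → R (π • a) (π • b))
    (hex : ∀ a, ∃ b, R a b ∧ MulAction.Supports (FinPerm 𝔸) (supp a) b) :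
    ∃ f : A ⟶ B, ∀ a, R a (f.toFun a) := by
  choose b hb hs using hex
  let rep : A → A := fun a =>
    Quotient.out (Quotient.mk (MulAction.orbitRel (FinPerm 𝔸) A) a)
  have hrep : ∀ a, ∃ π : FinPerm 𝔸, π • rep a = a := fun a =>
    MulAction.orbitRel_apply.1
      (Setoid.symm' _ (Quotient.mk_out (s := MulAction.orbitRel (FinPerm 𝔸) A) a))
  choose p hp using hrep
  have hrep_smul : ∀ (σ : FinPerm 𝔸) a, rep (σ • a) = rep a := fun σ a =>
    congrArg Quotient.out (Quotient.sound (MulAction.orbitRel_apply.2 ⟨σ, rfl⟩))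
  refine ⟨⟨fun a => p a • b (rep a), fun σ a => ?_⟩, fun a => ?_⟩
  · have h1 : ((σ * p a)⁻¹ * p (σ • a)) • rep a = rep a := by
      have h2 := hp (σ • a)
      rw [hrep_smul] at h2
      rw [mul_smul, h2, inv_smul_eq_iff, mul_smul, hp]
    have h3 := hs (rep a) _ fun c hc => hA _ _ h1 c hc
    rw [mul_smul, inv_smul_eq_iff, mul_smul] at h3
    simpa only [hrep_smul] using h3
  · have := hR (p a) _ _ (hb (rep a))
    rwa [hp] at this

/-! ### Elements of binary coproducts and of the terminal object -/

theorem coprod_cases {X Y : Nom.{u} 𝔸} (z : ↑(X ⨿ Y)) :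
    (∃ x : X, z = (coprod.inl : X ⟶ X ⨿ Y).toFun x) ∨
      ∃ y : Y, z = (coprod.inr : Y ⟶ X ⨿ Y).toFun y := by
  let e : (X ⨿ Y) ≅ sum X Y :=
    (coprodIsCoprod X Y).coconePointUniqueUpToIso (sumCofanIsColimit X Y)
  have hl : inl X Y ≫ e.inv = coprod.inl :=
    (coprodIsCoprod X Y).comp_coconePointUniqueUpToIso_inv (sumCofanIsColimit X Y)
      ⟨WalkingPair.left⟩
  have hr : inr X Y ≫ e.inv = coprod.inr :=
    (coprodIsCoprod X Y).comp_coconePointUniqueUpToIso_inv (sumCofanIsColimit X Y)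
      ⟨WalkingPair.right⟩
  have hz : e.inv.toFun (e.hom.toFun z) = z := congrArg (fun k => Hom.toFun k z) e.hom_inv_id
  rw [← hl, ← hr, ← hz]
  generalize e.hom.toFun z = s
  obtain x | y := s
  · exact Or.inl ⟨x, rfl⟩
  · exact Or.inr ⟨y, rfl⟩

theorem smul_terminal (π : FinPerm 𝔸) (t : ↑(⊤_ (Nom.{u} 𝔸))) : π • t = t := by
  let i : ⊤_ (Nom.{u} 𝔸) ⟶ one 𝔸 := ⟨fun _ => PUnit.unit, fun _ _ => rfl⟩
  have h : i ≫ terminal.from (one 𝔸) = 𝟙 _ := terminal.hom_ext _ _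
  have key : ∀ s, (terminal.from (one 𝔸)).toFun PUnit.unit = s := fun s =>
    congrArg (fun k => Hom.toFun k s) h
  exact (key _).symm.trans (key _)

/-! ### Jointly epic families -/

/-- The two-element nominal set of truth values, with the trivial action. -/
def prop (𝔸 : Type v) : Nom.{u} 𝔸 :=
  letI : MulAction (FinPerm 𝔸) (ULift.{u} Prop) :=
    { smul := fun _ x => x, one_smul := fun _ => rfl, mul_smul := fun _ _ _ => rfl }
  { carrier := ULift.{u} Prop
    exists_support := fun _ => ⟨∅, Set.finite_empty, fun _ _ => rfl⟩ }

theorem _root_.JointlyEpic.exists_toFun_eq {ι : Type w} {X : ι → Nom.{u} 𝔸} {Y : Nom.{u} 𝔸}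
    {e : ∀ i, X i ⟶ Y} (he : JointlyEpic e) (y : Y) : ∃ i x, (e i).toFun x = y := by
  -- The characteristic map of the union of the images is compared with the constant map `True`.
  let f : Y ⟶ prop 𝔸 := ⟨fun y => ULift.up (∃ i x, (e i).toFun x = y), fun π y => by
    refine congrArg ULift.up (propext ⟨?_, ?_⟩)
    · rintro ⟨i, x, hx⟩
      exact ⟨i, π⁻¹ • x, by rw [(e i).map_smul, hx, inv_smul_smul]⟩
    · rintro ⟨i, x, hx⟩
      exact ⟨i, π • x, by rw [(e i).map_smul, hx]⟩⟩
  let g : Y ⟶ prop 𝔸 := ⟨fun _ => ULift.up True, fun _ _ => rfl⟩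
  have hfg : f = g := he f g fun i => hom_ext fun x =>
    congrArg ULift.up (eq_true ⟨i, x, rfl⟩)
  have hy : ULift.up (∃ i x, (e i).toFun x = y) = ULift.up True :=
    congrArg (fun k => Hom.toFun k y) hfg
  exact of_eq_true (congrArg ULift.down hy)

/-! ### The nominal set of atoms -/

/-- The nominal set of atoms, transported to the universe `u` along `equivShrink`. -/
def atoms (𝔸 : Type v) [Small.{u} 𝔸] : Nom.{u} 𝔸 :=
  letI : MulAction (FinPerm 𝔸) (Shrink.{u} 𝔸) := (equivShrink 𝔸).symm.mulAction (FinPerm 𝔸)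
  { carrier := Shrink.{u} 𝔸
    exists_support := fun x => ⟨{(equivShrink 𝔸).symm x}, Set.finite_singleton _, fun π hπ => by
      change equivShrink 𝔸 (π • (equivShrink 𝔸).symm x) = x
      rw [hπ rfl, Equiv.apply_symm_apply]⟩ }

theorem exists_smul_atoms_ne [Infinite 𝔸] [Small.{u} 𝔸] (x : atoms.{u} 𝔸) :
    ∃ π : FinPerm 𝔸, π • x ≠ x := by
  classical
  obtain ⟨b, hb⟩ := exists_ne ((equivShrink 𝔸).symm x)
  refine ⟨transp ((equivShrink 𝔸).symm x) b, fun h => hb ?_⟩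
  have h' : equivShrink 𝔸 (transp ((equivShrink 𝔸).symm x) b • (equivShrink 𝔸).symm x) = x := h
  rw [transp_smul, Equiv.swap_apply_left] at h'
  exact (Equiv.eq_symm_apply _).2 h'

theorem strong_one (𝔸 : Type v) : strong.{u} 𝔸 (one 𝔸) := fun _ _ _ _ ha =>
  (ha ∅ Set.finite_empty fun _ _ => rfl).elim

end Nom

namespace PowersetVariant

open Nom

variable {𝔸 : Type v} (P : PowersetVariant.{u} 𝔸)

/-! ### The copairing of `η` and `⊥` -/

theorem smul_val {X : Nom.{u} 𝔸} (π : FinPerm 𝔸) (A : P.functor.obj X) :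
    (π • A).1 = π • A.1 := rfl

theorem unitBot_inl {Y : Nom.{u} 𝔸} (y : Y) :
    ((unitBot P.singleton P.empty Y).toFun ((coprod.inl : Y ⟶ _).toFun y)).1 = {y} := by
  have h : coprod.inl ≫ unitBot P.singleton P.empty Y = P.singleton.app Y := coprod.inl_desc _ _
  exact congrArg (fun k : Y ⟶ P.functor.obj Y => (k.toFun y).1) h

theorem unitBot_inr {Y : Nom.{u} 𝔸} (t : ↑(⊤_ (Nom.{u} 𝔸))) :
    ((unitBot P.singleton P.empty Y).toFun ((coprod.inr : _ ⟶ Y ⨿ _).toFun t)).1 = ∅ := by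
  have h : coprod.inr ≫ unitBot P.singleton P.empty Y = P.empty.app Y := coprod.inr_desc _ _
  exact congrArg (fun k : ⊤_ (Nom.{u} 𝔸) ⟶ P.functor.obj Y => (k.toFun t).1) h

/-! ### The axioms for uniformly finitely supported powersets -/

theorem supports_of_mem_ufs [Infinite 𝔸] {X : Nom.{u} 𝔸} {A : Set X}
    (hA : (⋃ x ∈ A, supp x).Finite) {S : Set 𝔸} (hS : S.Finite)
    (h : MulAction.Supports (FinPerm 𝔸) S A) {x : X} (hx : x ∈ A) :
    MulAction.Supports (FinPerm 𝔸) S x := by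
  classical
  refine (supports_supp x).mono fun a ha => ?_
  by_contra haS
  obtain ⟨b, hb⟩ := (hA.union hS).exists_notMem
  rw [Set.mem_union, not_or] at hb
  have hfix : transp a b • A = A := h _ fun c hc => by
    rw [transp_smul]
    refine Equiv.swap_apply_of_ne_of_ne ?_ ?_
    · rintro rfl
      exact haS hc
    · rintro rfl
      exact hb.2 hc
  have hmem : transp a b • x ∈ A := hfix ▸ Set.smul_mem_smul_set hx
  refine hb.1 (Set.mem_biUnion hmem ?_)
  rw [supp_smul]
  exact ⟨a, ha, by change transp a b • a = b; rw [transp_smul, Equiv.swap_apply_left]⟩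

/-- If all values of `P` are uniformly finitely supported, the elements of `f a` are supported by
the support of `a`. -/
theorem supports_of_mem_toFun [Infinite 𝔸]
    (hP : ∀ (X : Nom.{u} 𝔸) (A : Set X), P.mem X A → (⋃ x ∈ A, supp x).Finite)
    {A X : Nom.{u} 𝔸} (f : A ⟶ P.functor.obj X) {a : A} {x : X} (hx : x ∈ (f.toFun a).1) :
    MulAction.Supports (FinPerm 𝔸) (supp a) x :=
  supports_of_mem_ufs (hP X _ (f.toFun a).2) (finite_supp a)
    (fun π hπ => congrArg Subtype.val (supports_map f (supports_supp a) π hπ)) hx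

theorem axJoin [Infinite 𝔸]
    (hP : ∀ (X : Nom.{u} 𝔸) (A : Set X), P.mem X A → (⋃ x ∈ A, supp x).Finite) :
    AxJoin (strong.{u} 𝔸) P.pointwise P.singleton P.empty := by
  intro X Y hX f
  refine ⟨fun g hg => hg.1, fun g hg x y hy => ?_⟩
  -- A partial map below `f` is needed that takes the value `y` at `x`; it is undefined outside of
  -- the orbit of `x`.
  obtain ⟨f', hf'⟩ := exists_hom_of_rel (B := Y ⨿ ⊤_ (Nom.{u} 𝔸)) hX
    (fun a b => ((unitBot P.singleton P.empty Y).toFun b).1 ⊆ (f.toFun a).1 ∧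
      ∀ π : FinPerm 𝔸, π • x = a → π • y ∈ ((unitBot P.singleton P.empty Y).toFun b).1)
    (by
      rintro σ a b ⟨h1, h2⟩
      rw [Hom.map_smul, Hom.map_smul, smul_val, smul_val]
      refine ⟨Set.smul_set_mono h1, fun π hπ => ?_⟩
      rw [Set.mem_smul_set_iff_inv_smul_mem, ← mul_smul]
      exact h2 _ (by rw [mul_smul, hπ, inv_smul_smul]))
    (by
      intro a
      by_cases ha : ∃ π : FinPerm 𝔸, π • x = a
      · obtain ⟨π, rfl⟩ := ha
        have hmem : π • y ∈ (f.toFun (π • x)).1 := by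
          rw [Hom.map_smul, smul_val]
          exact Set.smul_mem_smul_set hy
        refine ⟨(coprod.inl : Y ⟶ _).toFun (π • y), ⟨?_, fun σ hσ => ?_⟩,
          supports_map _ (P.supports_of_mem_toFun hP f hmem)⟩
        · rwa [unitBot_inl, Set.singleton_subset_iff]
        · rw [unitBot_inl, Set.mem_singleton_iff]
          have h1 : (π⁻¹ * σ) • x = x := by rw [mul_smul, hσ, inv_smul_smul]
          have h2 := P.supports_of_mem_toFun hP f hy _ fun c hc => hX _ _ h1 c hc
          rwa [mul_smul, inv_smul_eq_iff] at h2
      · refine ⟨(coprod.inr : _ ⟶ Y ⨿ _).toFun ((terminal.from X).toFun a),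
          ⟨?_, fun π hπ => (ha ⟨π, hπ⟩).elim⟩,
          supports_map _ fun π _ => smul_terminal π _⟩
        rw [unitBot_inr]
        exact Set.empty_subset _)
  have hle := hg ⟨fun a => (hf' a).1, f', rfl⟩ x
  have hmem := (hf' x).2 1 (one_smul _ x)
  rw [one_smul] at hmem
  exact hle hmem

theorem axChoice [Infinite 𝔸]
    (hP : ∀ (X : Nom.{u} 𝔸) (A : Set X), P.mem X A → (⋃ x ∈ A, supp x).Finite) :
    AxChoice (strong.{u} 𝔸) P.pointwise P.singleton P.empty := by
  intro A X Y hA x y h hle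
  obtain ⟨x', hx'⟩ := exists_hom_of_rel (B := X ⨿ ⊤_ (Nom.{u} 𝔸)) hA
    (fun a b => ((unitBot P.singleton P.empty X).toFun b).1 ⊆ (x.toFun a).1 ∧
      (coprod.map h (𝟙 (⊤_ (Nom.{u} 𝔸)))).toFun b = y.toFun a)
    (by
      rintro σ a b ⟨h1, h2⟩
      rw [Hom.map_smul, Hom.map_smul, Hom.map_smul, Hom.map_smul, smul_val, smul_val, h2]
      exact ⟨Set.smul_set_mono h1, rfl⟩)
    (by
      intro a
      obtain ⟨y₀, hy₀⟩ | ⟨t, ht⟩ := coprod_cases (y.toFun a)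
      · have ha : ((unitBot P.singleton P.empty Y).toFun (y.toFun a)).1 ⊆
            h.toFun '' (x.toFun a).1 := hle a
        rw [hy₀, unitBot_inl, Set.singleton_subset_iff] at ha
        obtain ⟨x₀, hx₀, rfl⟩ := ha
        refine ⟨(coprod.inl : X ⟶ _).toFun x₀, ⟨?_, ?_⟩,
          supports_map _ (P.supports_of_mem_toFun hP x hx₀)⟩
        · rwa [unitBot_inl, Set.singleton_subset_iff]
        · rw [hy₀]
          exact congrArg (fun k => Hom.toFun k x₀) (coprod.inl_map h (𝟙 (⊤_ (Nom.{u} 𝔸))))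
      · refine ⟨(coprod.inr : _ ⟶ X ⨿ _).toFun t, ⟨?_, ?_⟩,
          supports_map _ fun π _ => smul_terminal π _⟩
        · rw [unitBot_inr]
          exact Set.empty_subset _
        · rw [ht]
          exact congrArg (fun k => Hom.toFun k t) (coprod.inr_map h (𝟙 (⊤_ (Nom.{u} 𝔸)))))
  exact ⟨x', fun a => (hx' a).1, hom_ext fun a => (hx' a).2⟩

theorem branchingAxioms [Infinite 𝔸]
    (hP : ∀ (X : Nom.{u} 𝔸) (A : Set X), P.mem X A → (⋃ x ∈ A, supp x).Finite) :
    BranchingAxioms.{u, max (u + 1) v, w} (strong.{u} 𝔸) P.pointwise P.singleton P.empty where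
  jointlyEpic _ _ _ _ _ he _ _ hfg y := by
    obtain ⟨i, x, rfl⟩ := he.exists_toFun_eq y
    exact hfg i x
  isBot _ _ _ _ := Set.empty_subset _
  join := P.axJoin hP
  choice := P.axChoice hP

/-! ### Failure of choice for finitely supported subsets -/

theorem not_axChoice_fs [Infinite 𝔸] [Small.{u} 𝔸] :
    ¬ AxChoice (strong.{u} 𝔸) (fs.{u} 𝔸).pointwise (fs.{u} 𝔸).singleton (fs.{u} 𝔸).empty := by
  intro hchoice
  -- `x` picks the set of all atoms, and `y` is totally defined.
  let x : one 𝔸 ⟶ (fs.{u} 𝔸).functor.obj (atoms 𝔸) :=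
    ⟨fun _ => ⟨Set.univ, ∅, Set.finite_empty, fun _ _ => Set.smul_set_univ⟩,
      fun _ _ => Subtype.ext Set.smul_set_univ.symm⟩
  let h : atoms.{u} 𝔸 ⟶ one 𝔸 := ⟨fun _ => PUnit.unit, fun _ _ => rfl⟩
  let y : one.{u} 𝔸 ⟶ one 𝔸 ⨿ ⊤_ (Nom.{u} 𝔸) := coprod.inl
  obtain ⟨x', -, hx'⟩ := hchoice (strong_one 𝔸) x y h (by
    rintro ⟨⟩ z -
    obtain ⟨c⟩ : Nonempty 𝔸 := inferInstance
    exact ⟨equivShrink 𝔸 c, Set.mem_univ _, rfl⟩)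
  obtain ⟨s⟩ : Nonempty (one.{u} 𝔸) := ⟨PUnit.unit⟩
  obtain ⟨a, ha⟩ | ⟨t, ht⟩ := coprod_cases (x'.toFun s)
  · -- `x'` is constant with value an atom, which would be fixed by all permutations.
    obtain ⟨π, hπ⟩ := exists_smul_atoms_ne a
    have hfix : (coprod.inl : atoms.{u} 𝔸 ⟶ atoms 𝔸 ⨿ ⊤_ (Nom.{u} 𝔸)).toFun (π • a) =
        (coprod.inl : atoms.{u} 𝔸 ⟶ atoms 𝔸 ⨿ ⊤_ (Nom.{u} 𝔸)).toFun a := by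
      rw [Hom.map_smul, ← ha]
      exact (x'.map_smul π s).symm
    have h2 := congrArg (fun z => ((unitBot (fs 𝔸).singleton (fs 𝔸).empty _).toFun z).1) hfix
    simp only [unitBot_inl, Set.singleton_eq_singleton_iff] at h2
    exact hπ h2
  · -- `x'` is nowhere undefined, since `y` is not.
    have h1 : (coprod.inr : _ ⟶ one.{u} 𝔸 ⨿ ⊤_ (Nom.{u} 𝔸)).toFun t =
        (coprod.inl : one.{u} 𝔸 ⟶ _ ⨿ ⊤_ (Nom.{u} 𝔸)).toFun s := by
      have hs : (x' ≫ coprod.map h (𝟙 (⊤_ (Nom.{u} 𝔸)))).toFun s = y.toFun s :=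
        congrArg (fun k => Hom.toFun k s) hx'
      refine Eq.trans ?_ hs
      rw [comp_toFun, ht]
      exact (congrArg (fun k => Hom.toFun k t) (coprod.inr_map h (𝟙 (⊤_ (Nom.{u} 𝔸))))).symm
    have h2 := congrArg (fun z => ((unitBot (fs 𝔸).singleton (fs 𝔸).empty _).toFun z).1) h1
    simp only [unitBot_inl, unitBot_inr] at h2
    exact (Set.singleton_ne_empty _ h2.symm).elim

end PowersetVariant

end

theorem proposition4p7 (𝔸 : Type v) [Countable 𝔸] [Infinite 𝔸] :
    (Nom.strong.{u} 𝔸).IsClosedUnderIsomorphisms ∧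
    BranchingAxioms.{u, max (u + 1) v, w} (Nom.strong.{u} 𝔸)
      (PowersetVariant.ufs.{u} 𝔸).pointwise (PowersetVariant.ufs.{u} 𝔸).singleton
      (PowersetVariant.ufs.{u} 𝔸).empty ∧
    BranchingAxioms.{u, max (u + 1) v, w} (Nom.strong.{u} 𝔸)
      (PowersetVariant.finite.{u} 𝔸).pointwise (PowersetVariant.finite.{u} 𝔸).singleton
      (PowersetVariant.finite.{u} 𝔸).empty ∧
    ¬ AxChoice (Nom.strong.{u} 𝔸)
      (PowersetVariant.fs.{u} 𝔸).pointwise (PowersetVariant.fs.{u} 𝔸).singleton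
      (PowersetVariant.fs.{u} 𝔸).empty :=
  ⟨Nom.strong_isClosedUnderIsomorphisms 𝔸,
    PowersetVariant.branchingAxioms _ fun _ _ hA => hA,
    PowersetVariant.branchingAxioms _ fun _ _ hA => Set.Finite.biUnion hA fun x _ =>
      Nom.finite_supp x,
    PowersetVariant.not_axChoice_fs⟩
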